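/- Let $n\ge 1$, let $S^n\subset\mathbb{R}^{n+1}$ be the unit sphere with its standard surface measure $\mu$, and let $N=(0,\dots,0,1)$ and $S=-N$ be its north and south poles. A function $f:S^n\to\mathbb{R}$ is called radially symmetric and decreasing with respect to a point $u\in S^n$ if there is a non-decreasing function $\phi:[-1,1]\to\mathbb{R}$ with $f(x)=\phi(x\cdot u)$ for all $x\in S^n$. For a continuous $f:S^n\to\mathbb{R}$, let $f^*:S^n\to\mathbb{R}$ denote its symmetric decreasing rearrangement, i.e. the unique function that is radially symmetric and decreasing with respect to $N$, satisfies $\mu(\{f^*>t\})=\mu(\{f>t\})$ for every $t\in\mathbb{R}$, is lower semicontinuous on $S^n\setminus\{S\}$, and has $f^*(S)=\operatorname{ess\,inf}_{S^n} f$. Let $k:[-1,1]\to\mathbb{R}$ be bounded and strictly increasing, and let $f,g:S^n\to\mathbb{R}$ be continuous and both non-constant. Suppose that $$\int_{S^n}\int_{S^n}k(x\cdot y)\,f(x)\,g(y)\,d\mu(x)\,d\mu(y)=\int_{S^n}\int_{S^n}k(x\cdot y)\,f^*(x)\,g^*(y)\,d\mu(x)\,d\mu(y).$$ Then there is a point $u\in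 S^n$ such that both $f$ and $g$ are radially symmetric and decreasing with respect to $u$. -/

import Mathlib

open MeasureTheory Set

/-- The unit sphere `Sⁿ` in `ℝⁿ⁺¹`. -/
abbrev USphere (n : ℕ) : Type := Metric.sphere (0 : EuclideanSpace ℝ (Fin (n + 1))) 1

namespace USphere

/-- The standard surface measure on `Sⁿ`. -/
noncomputable abbrev surf (n : ℕ) : Measure (USphere n) :=
  (volume : Measure (EuclideanSpace ℝ (Fin (n + 1)))).toSphere

/-- The dot product `x · y` of two points of the sphere. -/
noncomputable def dot {n : ℕ} (x y : USphere n) : ℝ :=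
  inner ℝ (x : EuclideanSpace ℝ (Fin (n + 1))) (y : EuclideanSpace ℝ (Fin (n + 1)))

/-- The north pole `(0, …, 0, 1)`. -/
noncomputable def north (n : ℕ) : USphere n :=
  ⟨EuclideanSpace.single (Fin.last n) 1, by simp⟩

/-- The south pole `(0, …, 0, -1)`. -/
noncomputable def south (n : ℕ) : USphere n := -north n

/-- `f` is radially symmetric and decreasing with respect to `u`: `f x = φ (x · u)` for an
increasing (not necessarily strictly increasing) `φ` on `[-1, 1]`. -/
def IsRadialDecreasing {n : ℕ} (f : USphere n → ℝ) (u : USphere n) : Prop :=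
  ∃ φ : ℝ → ℝ, MonotoneOn φ (Icc (-1) 1) ∧ ∀ x, f x = φ (dot x u)

/-- `F` is the symmetric decreasing rearrangement of `f`. -/
structure IsSymmetrization {n : ℕ} (f F : USphere n → ℝ) : Prop where
  radial : IsRadialDecreasing F (north n)
  measure_lt : ∀ t : ℝ, surf n {x | t < f x} = surf n {x | t < F x}
  lsc : LowerSemicontinuousOn F {south n}ᶜ
  south_eq : F (south n) = essInf f (surf n)

/-! ### Existence and uniqueness of the symmetrization of a continuous function -/

section aux

theorem exists_measure_lt {X : Type*} [MeasurableSpace X] (σ : Measure X) [IsFiniteMeasure σ]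
    (h : X → ℝ) (hm : Measurable h) (h0 : ∀ s, σ {x | h x = s} = 0) {s : ℝ} {c : ENNReal}
    (hs : σ {x | s < h x} < c) : ∃ s' < s, σ {x | s' < h x} < c := by
  by_contra! H
  have hanti : Antitone (fun k : ℕ => {x | s - 1 / ((k : ℝ) + 1) < h x}) := by
    intro i j hij x hx
    have h1 : 1 / ((j : ℝ) + 1) ≤ 1 / ((i : ℝ) + 1) := by gcongr
    simp only [mem_ofPred_eq] at hx ⊢
    linarith
  have ht := tendsto_measure_iInter_atTop (μ := σ)
    (fun k => (measurableSet_lt measurable_const hm).nullMeasurableSet) hanti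
    ⟨0, measure_ne_top _ _⟩
  have hI : (⋂ k : ℕ, {x | s - 1 / ((k : ℝ) + 1) < h x}) ⊆ {x | s < h x} ∪ {x | h x = s} := by
    intro x hx
    simp only [mem_iInter, mem_ofPred_eq, mem_union] at hx ⊢
    have : s ≤ h x := by
      by_contra hlt
      push Not at hlt
      obtain ⟨k, hk⟩ := exists_nat_one_div_lt (sub_pos.2 hlt)
      have := hx k
      linarith
    rcases this.lt_or_eq with h | h
    · exact Or.inl h
    · exact Or.inr h.symm
  have hle : c ≤ σ (⋂ k : ℕ, {x | s - 1 / ((k : ℝ) + 1) < h x}) := by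
    refine ge_of_tendsto' ht fun k => H _ ?_
    have : 0 < 1 / ((k : ℝ) + 1) := by positivity
    linarith
  have := calc
    c ≤ _ := hle
    _ ≤ _ := measure_mono hI
    _ ≤ _ := measure_union_le _ _
    _ = σ {x | s < h x} := by rw [h0, add_zero]
  exact absurd hs (not_lt.2 this)

theorem exists_gt_measure_lt {X : Type*} [MeasurableSpace X] (σ : Measure X)
    (h : X → ℝ) {s : ℝ} {c : ENNReal}
    (hs : c < σ {x | s < h x}) : ∃ s' > s, c < σ {x | s' < h x} := by
  by_contra! H
  have hmono : Monotone (fun k : ℕ => {x | s + 1 / ((k : ℝ) + 1) < h x}) := by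
    intro i j hij x hx
    have h1 : 1 / ((j : ℝ) + 1) ≤ 1 / ((i : ℝ) + 1) := by gcongr
    simp only [mem_ofPred_eq] at hx ⊢
    linarith
  have ht := tendsto_measure_iUnion_atTop (μ := σ) hmono
  have hI : {x | s < h x} ⊆ (⋃ k : ℕ, {x | s + 1 / ((k : ℝ) + 1) < h x}) := by
    intro x hx
    simp only [mem_iUnion, mem_ofPred_eq] at hx ⊢
    obtain ⟨k, hk⟩ := exists_nat_one_div_lt (sub_pos.2 hx)
    exact ⟨k, by linarith⟩
  have hle : σ (⋃ k : ℕ, {x | s + 1 / ((k : ℝ) + 1) < h x}) ≤ c := by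
    refine le_of_tendsto' ht fun k => H _ ?_
    have : 0 < 1 / ((k : ℝ) + 1) := by positivity
    simp only [gt_iff_lt]
    linarith
  exact absurd hs (not_lt.2 ((measure_mono hI).trans hle))

theorem measure_measure_lt {X : Type*} [MeasurableSpace X] (σ : Measure X) [IsFiniteMeasure σ]
    (h : X → ℝ) (hm : Measurable h) (h0 : ∀ s, σ {x | h x = s} = 0)
    (hb : ∀ x, -1 ≤ h x ∧ h x ≤ 1) {c : ENNReal} (hc : c ≤ σ univ) :
    σ {x | σ {y | h x < h y} < c} = c := by
  rcases eq_or_ne c 0 with rfl | hc0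
  · simp
  set B : Set ℝ := {s | σ {y | s < h y} < c} with hB
  have hup : ∀ s ∈ B, ∀ s', s ≤ s' → s' ∈ B := fun s hs s' hss' =>
    lt_of_le_of_lt (measure_mono fun x hx => lt_of_le_of_lt hss' hx) hs
  have h1B : (1 : ℝ) ∈ B := by
    have : {y | 1 < h y} = ∅ := by
      ext y; simpa using (hb y).2
    simp only [hB, mem_ofPred_eq, this, measure_empty]
    exact pos_iff_ne_zero.2 hc0
  have hbb : BddBelow B := by
    refine ⟨-2, fun s hs => ?_⟩
    by_contra hlt
    push Not at hlt
    have : {y | s < h y} = univ := by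
      ext y; simp only [mem_ofPred_eq, mem_univ, iff_true]; linarith [(hb y).1]
    simp only [hB, mem_ofPred_eq, this] at hs
    exact absurd hs (not_lt.2 hc)
  set a := sInf B with ha
  have hTsub : {x | σ {y | h x < h y} < c} ⊆ {x | a < h x} ∪ {x | h x = a} := by
    intro x hx
    have : a ≤ h x := csInf_le hbb hx
    rcases this.lt_or_eq with h | h
    · exact Or.inl h
    · exact Or.inr h.symm
  have hsubT : {x | a < h x} ⊆ {x | σ {y | h x < h y} < c} := by
    intro x hx
    obtain ⟨s, hs, hsx⟩ := (csInf_lt_iff hbb ⟨1, h1B⟩).1 hx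
    exact hup s hs _ hsx.le
  have hA1 : σ {x | a < h x} ≤ c := by
    by_contra! hlt
    obtain ⟨s', hs', hlt'⟩ := exists_gt_measure_lt σ h hlt
    obtain ⟨s, hs, hsx⟩ := (csInf_lt_iff hbb ⟨1, h1B⟩).1 hs'
    exact absurd (hup s hs _ hsx.le) (not_lt.2 hlt'.le)
  have hA2 : c ≤ σ {x | a < h x} := by
    by_contra! hlt
    obtain ⟨s', hs', hlt'⟩ := exists_measure_lt σ h hm h0 hlt
    exact absurd (csInf_le hbb hlt') (not_le.2 hs')
  refine le_antisymm ?_ (hA2.trans (measure_mono hsubT))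
  calc _ ≤ _ := measure_mono hTsub
    _ ≤ _ := measure_union_le _ _
    _ = σ {x | a < h x} := by rw [h0, add_zero]
    _ ≤ c := hA1

end aux

variable {n : ℕ}

theorem dot_mem_Icc (x y : USphere n) : dot x y ∈ Icc (-1 : ℝ) 1 := by
  have h := abs_real_inner_le_norm (x : EuclideanSpace ℝ (Fin (n + 1)))
    (y : EuclideanSpace ℝ (Fin (n + 1)))
  rw [norm_eq_of_mem_sphere x, norm_eq_of_mem_sphere y, one_mul] at h
  exact abs_le.1 h

theorem continuous_dot (y : USphere n) : Continuous fun x : USphere n => dot x y := by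
  unfold dot; fun_prop

theorem dot_north_eq_neg_one {x : USphere n} : dot x (north n) = -1 ↔ x = south n := by
  constructor
  · intro h
    have h1 := (inner_eq_neg_one_iff_of_norm_eq_one (𝕜 := ℝ) (norm_eq_of_mem_sphere x)
      (norm_eq_of_mem_sphere (north n))).1 h
    exact Subtype.ext h1
  · rintro rfl
    simp [dot, south]

open scoped Pointwise in
theorem surf_level (hn : 1 ≤ n) (s : ℝ) : surf n {x | dot x (north n) = s} = 0 := by
  have hmeas : MeasurableSet {x : USphere n | dot x (north n) = s} :=
    (isClosed_eq (continuous_dot _) continuous_const).measurableSet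
  rw [surf, Measure.toSphere_apply' _ hmeas]
  set e : EuclideanSpace ℝ (Fin (n + 1)) := (north n : EuclideanSpace ℝ (Fin (n + 1))) with he
  have hen : ‖e‖ = 1 := norm_eq_of_mem_sphere (north n)
  set W : Submodule ℝ (EuclideanSpace ℝ (Fin (n + 1))) := Submodule.span ℝ {e} with hW
  set C : Set (EuclideanSpace ℝ (Fin (n + 1))) := {y | inner ℝ y e = s * ‖y‖} \ W with hC
  have hsub : Ioo (0 : ℝ) 1 • ((↑) '' {x : USphere n | dot x (north n) = s}) ⊆ C ∪ W := by
    rintro _ ⟨r, hr, _, ⟨x, hx, rfl⟩, rfl⟩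
    by_cases hw : r • (x : EuclideanSpace ℝ (Fin (n + 1))) ∈ W
    · exact Or.inr hw
    · refine Or.inl ⟨?_, hw⟩
      have hx' : inner ℝ (x : EuclideanSpace ℝ (Fin (n + 1))) e = s := hx
      simp only [mem_ofPred_eq, inner_smul_left, norm_smul, norm_eq_of_mem_sphere x, hx']
      simp [abs_of_pos hr.1]; ring
  have hWtop : W ≠ ⊤ := by
    intro h
    have h1 := finrank_span_singleton (K := ℝ) (v := e) (by intro h0; simp [h0] at hen)
    rw [← hW, h, finrank_top, finrank_euclideanSpace, Fintype.card_fin] at h1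
    omega
  have hW0 : volume (W : Set (EuclideanSpace ℝ (Fin (n + 1)))) = 0 :=
    Measure.addHaar_submodule volume W hWtop
  have hCm : MeasurableSet C :=
    (isClosed_eq (by fun_prop) (by fun_prop)).measurableSet.diff
      (Submodule.closed_of_finiteDimensional W).measurableSet
  have hC0 : volume C = 0 := by
    refine Measure.addHaar_eq_zero_of_disjoint_translates volume
      (fun k : ℕ => (1 / ((k : ℝ) + 1)) • e) ?_ ?_ hCm
    · refine (Metric.isBounded_iff_subset_closedBall 0).2 ⟨1, ?_⟩
      rintro _ ⟨k, rfl⟩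
      have h0 : 0 < 1 / ((k : ℝ) + 1) := by positivity
      have : 1 / ((k : ℝ) + 1) ≤ 1 := by
        rw [div_le_one (by positivity)]; linarith [(Nat.cast_nonneg k : (0 : ℝ) ≤ k)]
      rw [mem_closedBall_zero_iff, norm_smul, hen, mul_one, Real.norm_of_nonneg h0.le]
      exact this
    · intro i j hij
      simp only [Function.onFun, singleton_add, disjoint_left]
      rintro _ ⟨y, hy, rfl⟩ ⟨z, hz, hzy⟩
      simp only at hzy
      set t : ℝ := 1 / ((i : ℝ) + 1) - 1 / ((j : ℝ) + 1) with ht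
      have htn : t ≠ 0 := by
        intro h
        have : (1 : ℝ) / ((i : ℝ) + 1) = 1 / ((j : ℝ) + 1) := sub_eq_zero.1 h
        rw [div_eq_div_iff (by positivity) (by positivity)] at this
        apply hij
        exact_mod_cast (by linarith : (i : ℝ) = j)
      have hzt : z - y = t • e := by
        rw [ht, sub_smul, sub_eq_sub_iff_add_eq_add, ← hzy]
        exact add_comm _ _
      have hs1 : |s| ≤ 1 := by
        have h1 := abs_real_inner_le_norm y e
        have hy0 : 0 < ‖y‖ := norm_pos_iff.2 fun h => hy.2 (h ▸ W.zero_mem)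
        rw [hy.1, hen, abs_mul, abs_norm, mul_one] at h1
        exact le_of_mul_le_mul_right (by linarith) hy0
      have h2 : t = s * (‖z‖ - ‖y‖) := by
        have : inner ℝ (z - y) e = t := by
          rw [hzt, inner_smul_left, real_inner_self_eq_norm_sq, hen]; simp
        rw [inner_sub_left, hz.1, hy.1] at this
        linarith
      have h3 : ¬ SameRay ℝ z y := by
        intro hr
        have hr' := hr
        rcases hr with h | h | ⟨r₁, r₂, h1, h2', h3⟩
        · exact hz.2 (h ▸ W.zero_mem)
        · exact hy.2 (h ▸ W.zero_mem)
        · have hz' : z = y + t • e := by rw [← hzt]; abel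
          replace h3 : (r₂ - r₁) • y = r₁ • t • e := by
            rw [sub_smul, ← h3, hz', smul_add, add_sub_cancel_left]
          by_cases h12 : r₂ - r₁ = 0
          · rw [h12, zero_smul, eq_comm, smul_smul, smul_eq_zero] at h3
            rcases h3 with h3 | h3
            · exact (mul_ne_zero h1.ne' htn) h3
            · simp [h3] at hen
          · apply hy.2
            have : y = (r₂ - r₁)⁻¹ • (r₁ • t • e) := by
              rw [← h3, smul_smul, inv_mul_cancel₀ h12, one_smul]
            rw [this]
            exact W.smul_mem _ (W.smul_mem _ (W.smul_mem _ (Submodule.mem_span_singleton_self e)))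
      have h4 := abs_lt_norm_sub_of_not_sameRay h3
      rw [hzt, norm_smul, hen, mul_one, Real.norm_eq_abs] at h4
      have h5 : |t| ≤ |‖z‖ - ‖y‖| := by
        conv_lhs => rw [h2, abs_mul]
        exact mul_le_of_le_one_left (abs_nonneg _) hs1
      linarith
  rw [measure_mono_null hsub (measure_union_null hC0 hW0), mul_zero]

/-- A continuous function on `Sⁿ`, `n ≥ 1`, has a symmetric decreasing rearrangement. -/
theorem exists_isSymmetrization (hn : 1 ≤ n) (f : C(USphere n, ℝ)) :
    ∃ F : USphere n → ℝ, IsSymmetrization f F := by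
  set σ := surf n with hσ
  have hne : σ ≠ 0 := Measure.toSphere_ne_zero _
  have : (ae σ).NeBot := ae_neBot.2 hne
  set h : USphere n → ℝ := fun x => dot x (north n) with hh
  have hcont : Continuous h := continuous_dot _
  have hb : ∀ x, -1 ≤ h x ∧ h x ≤ 1 := fun x => dot_mem_Icc x _
  have h0 : ∀ s, σ {x | h x = s} = 0 := surf_level hn
  have h1 : h (south n) = -1 := dot_north_eq_neg_one.2 rfl
  obtain ⟨M, hM⟩ : ∃ M, ∀ x, |f x| ≤ M := by
    obtain ⟨M, hM⟩ := (isCompact_range f.continuous).isBounded.exists_norm_le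
    exact ⟨M, fun x => hM _ ⟨x, rfl⟩⟩
  set m : ℝ → ENNReal := fun t => σ {x | t < f x} with hm
  have hmanti : ∀ {s t}, s ≤ t → m t ≤ m s := fun hst =>
    measure_mono fun x hx => lt_of_le_of_lt hst hx
  set A : ℝ → ENNReal := fun s => σ {y | s < h y} with hA
  have hAanti : ∀ {s t}, s ≤ t → A t ≤ A s := fun hst =>
    measure_mono fun x hx => lt_of_le_of_lt hst hx
  have hAlt : ∀ s, -1 < s → A s < σ univ := by
    intro s hs
    have hpos : 0 < σ {y | h y < s} :=
      (isOpen_lt hcont continuous_const).measure_pos _ ⟨south n, by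
        simp only [mem_ofPred_eq, h1]; exact hs⟩
    have hd : σ {y | h y < s} + A s ≤ σ univ := by
      have hdis : Disjoint {y | h y < s} {y | s < h y} := by
        rw [disjoint_left]; intro y hy hy'
        simp only [mem_ofPred_eq] at hy hy'
        linarith
      change σ {y | h y < s} + σ {y | s < h y} ≤ σ univ
      rw [← measure_union hdis (measurableSet_lt measurable_const hcont.measurable)]
      exact measure_mono (subset_univ _)
    refine lt_of_lt_of_le ?_ hd
    rw [add_comm]
    exact ENNReal.lt_add_right (measure_ne_top _ _) hpos.ne'
  have hAL : ∀ s t, -1 < s → t < essInf f σ → A s < m t := by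
    intro s t hs ht
    have hbd : Filter.IsBoundedUnder (· ≥ ·) (ae σ) f :=
      Filter.isBoundedUnder_of ⟨-M, fun x => (abs_le.1 (hM x)).1⟩
    have : m t = σ univ := by
      refine measure_congr ?_
      filter_upwards [ae_essInf_le hbd] with x hx
      exact eq_true (lt_of_lt_of_le ht hx)
    rw [this]; exact hAlt s hs
  set E : ℝ → Set ℝ := fun s => {t | A s < m t} with hE
  have hEb : ∀ s, BddAbove (E s) := by
    refine fun s => ⟨M, fun t ht => ?_⟩
    by_contra! hlt
    have : {x | t < f x} = ∅ := by
      ext x; simp only [mem_ofPred_eq, mem_empty_iff_false, iff_false, not_lt]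
      exact ((abs_le.1 (hM x)).2).trans hlt.le
    simp [hE, hm, this] at ht
  have hEne : ∀ s, -1 < s → (E s).Nonempty := fun s hs =>
    ⟨essInf f σ - 1, hAL s _ hs (by linarith)⟩
  set φ : ℝ → ℝ := fun s => if s ≤ -1 then essInf f σ else sSup (E s) with hφ
  have hφlt : ∀ s t, -1 < s → (t < φ s ↔ A s < m t) := by
    intro s t hs
    simp only [hφ, if_neg (not_le.2 hs)]
    constructor
    · intro ht
      obtain ⟨t', ht', htt'⟩ := exists_lt_of_lt_csSup (hEne s hs) ht
      exact lt_of_lt_of_le ht' (hmanti htt'.le)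
    · intro ht
      obtain ⟨t', ht', htt'⟩ := exists_gt_measure_lt σ f ht
      exact lt_of_lt_of_le ht' (le_csSup (hEb s) htt')
  have hLφ : ∀ s, essInf f σ ≤ φ s := by
    intro s
    by_cases hs : s ≤ -1
    · simp [hφ, hs]
    · refine le_of_forall_lt fun t ht => (hφlt s t (not_le.1 hs)).2 (hAL s t (not_le.1 hs) ht)
  have hφmono : Monotone φ := by
    intro s s' hss'
    by_cases hs : s ≤ -1
    · have : φ s = essInf f σ := by simp [hφ, hs]
      rw [this]; exact hLφ s'
    · push Not at hs
      refine le_of_forall_lt fun t ht => (hφlt s' t (hs.trans_le hss')).2 ?_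
      exact lt_of_le_of_lt (hAanti hss') ((hφlt s t hs).1 ht)
  have hns : ∀ x, x ≠ south n → -1 < h x := fun x hx =>
    lt_of_le_of_ne (hb x).1 fun h' => hx (dot_north_eq_neg_one.1 h'.symm)
  have hS0 : σ {south n} = 0 := by
    have : ({south n} : Set (USphere n)) = {x | h x = -1} := by
      ext x; exact dot_north_eq_neg_one.symm
    rw [this]; exact h0 _
  refine ⟨fun x => φ (h x), ⟨φ, hφmono.monotoneOn _, fun x => rfl⟩, ?_, ?_, ?_⟩
  · intro t
    have key := measure_measure_lt σ h hcont.measurable h0 hb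
      (c := m t) (measure_mono (subset_univ _))
    have : σ {x | t < φ (h x)} = σ {x | σ {y | h x < h y} < m t} := by
      refine measure_congr ?_
      have hae : ∀ᵐ x ∂σ, x ≠ south n := by
        rw [ae_iff]; simpa using hS0
      filter_upwards [hae] with x hx
      exact propext (hφlt (h x) t (hns x hx))
    rw [this, key]
  · intro x hx t ht
    have hx' := hns x hx
    obtain ⟨s', hs', hlt⟩ := exists_measure_lt σ h hcont.measurable h0
      ((hφlt (h x) t hx').1 ht)
    have hev : ∀ᶠ y in nhdsWithin x {south n}ᶜ, s' < h y :=
      (hcont.continuousAt.eventually_const_lt hs').filter_mono nhdsWithin_le_nhds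
    filter_upwards [hev, self_mem_nhdsWithin] with y hy hyS
    exact (hφlt (h y) t (hns y hyS)).2 (lt_of_le_of_lt (hAanti hy.le) hlt)
  · simp [hφ, h1, hσ]

/-- The symmetric decreasing rearrangement is unique. -/
theorem IsSymmetrization.unique (hn : 1 ≤ n) {f F G : USphere n → ℝ}
    (hF : IsSymmetrization f F) (hG : IsSymmetrization f G) : F = G := by
  have key : ∀ {F G : USphere n → ℝ}, IsSymmetrization f F → IsSymmetrization f G →
      ∀ x, G x ≤ F x := by
    intro F G hF hG x
    by_cases hxS : x = south n
    · rw [hxS, hF.south_eq, hG.south_eq]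
    by_contra! hlt
    obtain ⟨t, ht1, ht2⟩ := exists_between hlt
    obtain ⟨φ, hφ, hFφ⟩ := hF.radial
    obtain ⟨ψ, hψ, hGψ⟩ := hG.radial
    set h : USphere n → ℝ := fun x => dot x (north n) with hh
    have hcont : Continuous h := continuous_dot _
    have hFsub : {y | t < F y} ⊆ {y | h x < h y} := by
      intro y hy
      by_contra hle
      have : F y ≤ F x := by
        rw [hFφ, hFφ]; exact hφ (dot_mem_Icc _ _) (dot_mem_Icc _ _) (not_lt.1 hle)
      exact absurd (lt_of_lt_of_le hy this) (not_lt.2 ht1.le)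
    have hGup : ∀ y z, t < G y → h y ≤ h z → t < G z := by
      intro y z hy hyz
      refine lt_of_lt_of_le hy ?_
      rw [hGψ, hGψ]; exact hψ (dot_mem_Icc _ _) (dot_mem_Icc _ _) hyz
    have : PreconnectedSpace (USphere n) := by
      refine Subtype.preconnectedSpace (isPreconnected_sphere ?_ _ _)
      rw [← Module.finrank_eq_rank, finrank_euclideanSpace, Fintype.card_fin]
      exact_mod_cast (by omega : 1 < n + 1)
    have hSlt : ∀ y, y ≠ south n → h (south n) < h y := by
      intro y hy
      have h1 : h (south n) = -1 := dot_north_eq_neg_one.2 rfl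
      rw [h1]
      exact lt_of_le_of_ne (dot_mem_Icc y (north n)).1
        fun h' => hy (dot_north_eq_neg_one.1 h'.symm)
    obtain ⟨z, hzt, hzx⟩ : ∃ z, t < G z ∧ h z < h x := by
      by_contra! H
      have hset : {y | t < G y} = {y | h x ≤ h y} := by
        ext y
        exact ⟨fun hy => H y hy, fun hy => hGup x y ht2 hy⟩
      have hop : IsOpen {y | h x ≤ h y} := by
        rw [isOpen_iff_mem_nhds]
        intro y hy
        have hyS : y ≠ south n := by
          rintro rfl
          exact absurd hy (not_le.2 (hSlt x hxS))
        have hyt : t < G y := hGup x y ht2 hy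
        have := hG.lsc y hyS t hyt
        rw [nhdsWithin_eq_nhds.2 (isOpen_compl_singleton.mem_nhds hyS)] at this
        rw [← hset]; exact this
      have hcl : IsClopen {y | h x ≤ h y} := ⟨isClosed_le continuous_const hcont, hop⟩
      have huniv := hcl.eq_univ ⟨x, (le_refl (h x) : _)⟩
      have : south n ∈ {y | h x ≤ h y} := huniv ▸ mem_univ _
      exact absurd this (not_le.2 (hSlt x hxS))
    obtain ⟨s, hs1, hs2⟩ := exists_between hzx
    have hpos : 0 < surf n ({y | h z < h y} ∩ {y | h y < h x}) := by
      refine ((isOpen_lt continuous_const hcont).inter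
        (isOpen_lt hcont continuous_const)).measure_pos _ ?_
      obtain ⟨w, hw⟩ := mem_range_of_exists_le_of_exists_ge hcont ⟨z, hs1.le⟩ ⟨x, hs2.le⟩
      exact ⟨w, by simp only [mem_ofPred_eq, hw]; exact hs1,
        by simp only [mem_ofPred_eq, hw]; exact hs2⟩
    have hle : surf n {y | h x < h y} + surf n ({y | h z < h y} ∩ {y | h y < h x})
        ≤ surf n {y | t < G y} := by
      have hdis : Disjoint {y | h x < h y} ({y | h z < h y} ∩ {y | h y < h x}) := by
        rw [disjoint_left]; intro y hy hy'
        simp only [mem_ofPred_eq, mem_inter_iff] at hy hy'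
        linarith
      rw [← measure_union hdis (((isOpen_lt continuous_const hcont).inter
        (isOpen_lt hcont continuous_const)).measurableSet)]
      refine measure_mono ?_
      rintro y (hy | hy)
      · exact hGup z y hzt (hzx.le.trans (le_of_lt hy))
      · exact hGup z y hzt (le_of_lt hy.1)
    rw [← hG.measure_lt, hF.measure_lt] at hle
    have h2 := hle.trans (measure_mono hFsub)
    exact absurd h2 (not_le.2 (ENNReal.lt_add_right (measure_ne_top _ _) hpos.ne'))
  funext x
  exact le_antisymm (key hG hF x) (key hF hG x)

/-- The symmetric decreasing rearrangement `f*` of a continuous function `f` on `Sⁿ`, `n ≥ 1`: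
the unique function with the defining properties. -/
noncomputable def symmetrization (hn : 1 ≤ n) (f : C(USphere n, ℝ)) : USphere n → ℝ :=
  Classical.choose (exists_isSymmetrization hn f)

theorem isSymmetrization_symmetrization (hn : 1 ≤ n) (f : C(USphere n, ℝ)) :
    IsSymmetrization f (symmetrization hn f) :=
  Classical.choose_spec (exists_isSymmetrization hn f)

end USphere

/-!
Reflections `reflect v` of the sphere generate two-point rearrangements (polarizations). A
polarization never decreases the Riesz form, already for the sum of the integrand over the four
pairs obtained from `(x, y)` by reflecting either point. Among the rearrangements of `f` and `g`
with controlled modulus of continuity whose Riesz form is at least that of `(f, g)`, those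
maximizing the component of the first moments along the north pole are fixed by every polarization
towards the pole, hence equal `f*` and `g*`; this is the Riesz inequality.

Since polarizing does not change `f*` and `g*`, equality in the Riesz inequality forces equality
for every polarization, so the differences of `f` and of `g` across any reflection have a common
sign. The sign is then read off from the first moments `∫ f x • x` and `∫ g x • x`, which lie on a
common ray; its direction is the point `u`. They do not vanish, because otherwise `f` would be
invariant under all reflections in an open set of directions and therefore constant.
-/

namespace USphere

open scoped RealInnerProductSpace BoundedContinuousFunction Topology

section Reflection

variable {E E' : Type*} [NormedAddCommGroup E] [InnerProductSpace ℝ E]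
  [NormedAddCommGroup E'] [InnerProductSpace ℝ E']

theorem sameRay_of_forall_inner_nonneg {a b : E} (h : ∀ v, 0 < ⟪a, v⟫ → 0 ≤ ⟪b, v⟫) :
    SameRay ℝ a b := by
  rw [sameRay_iff_norm_smul_eq, eq_comm, ← inner_eq_norm_mul_iff_real]
  by_contra hne
  have hlt : ⟪a, b⟫ < ‖a‖ * ‖b‖ := lt_of_le_of_ne (real_inner_le_norm a b) hne
  have ha : 0 < ‖a‖ := norm_pos_iff.2 fun h0 => by simp [h0] at hlt
  have hb : 0 < ‖b‖ := norm_pos_iff.2 fun h0 => by simp [h0] at hlt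
  have hav : ⟪a, ‖b‖ • a - ‖a‖ • b⟫ = ‖a‖ * (‖a‖ * ‖b‖ - ⟪a, b⟫) := by
    rw [inner_sub_right, inner_smul_right, inner_smul_right, real_inner_self_eq_norm_sq]
    ring
  have hbv : ⟪b, ‖b‖ • a - ‖a‖ • b⟫ = -(‖b‖ * (‖a‖ * ‖b‖ - ⟪a, b⟫)) := by
    rw [inner_sub_right, inner_smul_right, inner_smul_right, real_inner_self_eq_norm_sq,
      real_inner_comm]
    ring
  have hav_pos := mul_pos ha (sub_pos.2 hlt)
  have hbv_pos := mul_pos hb (sub_pos.2 hlt)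
  have := h _ (hav ▸ hav_pos)
  linarith

variable (E) in
/-- The unit sphere of a normed space; `USphere n` is the case `E = ℝⁿ⁺¹`. -/
abbrev UnitSphere : Type _ := Metric.sphere (0 : E) 1

theorem inner_mem_Icc (x y : UnitSphere E) : ⟪(x : E), y⟫ ∈ Icc (-1 : ℝ) 1 := by
  simpa [← abs_le] using abs_real_inner_le_norm (x : E) y

theorem dist_sq_eq (x y : UnitSphere E) : dist x y ^ 2 = 2 - 2 * ⟪(x : E), y⟫ := by
  rw [Subtype.dist_eq, dist_eq_norm, norm_sub_sq_real, norm_eq_of_mem_sphere,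
    norm_eq_of_mem_sphere]
  ring

theorem inner_sub_pos {x y : UnitSphere E} (h : x ≠ y) : 0 < ⟪(x : E), x - y⟫ := by
  have hd : 0 < dist x y ^ 2 := pow_pos (dist_pos.2 h) 2
  rw [dist_sq_eq] at hd
  rw [inner_sub_right, real_inner_self_eq_norm_sq, norm_eq_of_mem_sphere]
  linarith

/-- The isometry between unit spheres that a linear isometry restricts to. -/
def sphereIsometry (L : E ≃ₗᵢ[ℝ] E') : UnitSphere E ≃ᵢ UnitSphere E' where
  toFun x := ⟨L x, by simp⟩
  invFun y := ⟨L.symm y, by simp⟩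
  left_inv x := Subtype.ext (L.symm_apply_apply _)
  right_inv y := Subtype.ext (L.apply_symm_apply _)
  isometry_toFun x y := L.isometry.edist_eq x y

/-- The reflection of the unit sphere in the hyperplane `vᗮ`; it is the identity for `v = 0`. -/
noncomputable def reflect (v : E) : UnitSphere E ≃ᵢ UnitSphere E :=
  sphereIsometry (ℝ ∙ v)ᗮ.reflection

theorem coe_reflect (v : E) (x : UnitSphere E) :
    (reflect v x : E) = x - (2 * ⟪(x : E), v⟫ / ‖v‖ ^ 2) • v := by
  change (ℝ ∙ v)ᗮ.reflection (x : E) = _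
  rw [Submodule.reflection_orthogonal_apply, Submodule.reflection_singleton_apply,
    real_inner_comm, RCLike.ofReal_real_eq_id, id, neg_sub, two_nsmul, ← add_smul]
  ring_nf

@[simp]
theorem reflect_reflect (v : E) (x : UnitSphere E) : reflect v (reflect v x) = x :=
  Subtype.ext (Submodule.reflection_reflection _ _)

@[simp]
theorem inner_reflect_reflect (v : E) (x y : UnitSphere E) :
    ⟪(reflect v x : E), reflect v y⟫ = ⟪(x : E), y⟫ :=
  LinearIsometryEquiv.inner_map_map (ℝ ∙ v)ᗮ.reflection _ _

theorem inner_reflect_right (v : E) (x y : UnitSphere E) :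
    ⟪(x : E), reflect v y⟫ = ⟪(reflect v x : E), y⟫ := by
  rw [← inner_reflect_reflect v, reflect_reflect]

@[simp]
theorem inner_reflect_self (v : E) (x : UnitSphere E) :
    ⟪(reflect v x : E), v⟫ = -⟪(x : E), v⟫ := by
  have h := LinearIsometryEquiv.inner_map_map (ℝ ∙ v)ᗮ.reflection (x : E) v
  rw [Submodule.reflection_orthogonalComplement_singleton_eq_neg, inner_neg_right] at h
  exact neg_eq_iff_eq_neg.1 h

theorem reflect_eq_self {v : E} {x : UnitSphere E} (h : ⟪(x : E), v⟫ = 0) : reflect v x = x :=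
  Subtype.ext (by simp [coe_reflect, h])

theorem reflect_sub (x y : UnitSphere E) : reflect ((x : E) - y) x = y :=
  Subtype.ext (Submodule.reflection_sub (by simp))

theorem reflect_smul {c : ℝ} (hc : c ≠ 0) (v : E) : reflect (c • v) = reflect v := by
  simp only [reflect, Submodule.span_singleton_smul_eq (IsUnit.mk0 c hc) v]

theorem continuousAt_reflect {v : E} (hv : v ≠ 0) (x : UnitSphere E) :
    ContinuousAt (fun w => reflect w x) v := by
  rw [Topology.IsInducing.subtypeVal.continuousAt_iff]
  have hv' : ‖v‖ ^ 2 ≠ 0 := pow_ne_zero _ (norm_ne_zero_iff.2 hv)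
  simp only [Function.comp_def, coe_reflect]
  fun_prop (disch := assumption)

theorem inner_sub_inner_reflect (u v : E) (x : UnitSphere E) :
    ⟪(x : E), u⟫ - ⟪(reflect v x : E), u⟫ = 2 * (⟪(x : E), v⟫ * ⟪u, v⟫) / ‖v‖ ^ 2 := by
  rw [coe_reflect, inner_sub_left, real_inner_smul_left, real_inner_comm u v]
  ring

theorem inner_reflect_le_inner {u v : E} {x : UnitSphere E} (h : 0 ≤ ⟪(x : E), v⟫ * ⟪u, v⟫) :
    ⟪(reflect v x : E), u⟫ ≤ ⟪(x : E), u⟫ := by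
  rw [← sub_nonneg, inner_sub_inner_reflect]
  positivity

theorem inner_reflect_lt_inner {u v : E} {x : UnitSphere E} (h : 0 < ⟪(x : E), v⟫ * ⟪u, v⟫) :
    ⟪(reflect v x : E), u⟫ < ⟪(x : E), u⟫ := by
  have hv : 0 < ‖v‖ := norm_pos_iff.2 fun h0 => by simp [h0] at h
  rw [← sub_pos, inner_sub_inner_reflect]
  positivity

theorem dist_le_dist_reflect {v : E} {x y : UnitSphere E}
    (h : 0 ≤ ⟪(x : E), v⟫ * ⟪(y : E), v⟫) : dist x y ≤ dist (reflect v x) y := by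
  rw [← sq_le_sq₀ dist_nonneg dist_nonneg, dist_sq_eq, dist_sq_eq]
  linarith [inner_reflect_le_inner h]

end Reflection

section SurfaceMeasure

variable {X : Type*} [TopologicalSpace X] [CompactSpace X] [MeasurableSpace X] [BorelSpace X]
  {μ : Measure X} [IsFiniteMeasure μ]

theorem integrable_of_continuous {E : Type*} [NormedAddCommGroup E]
    [SecondCountableTopologyEither X E] {h : X → E} (hh : Continuous h) : Integrable h μ :=
  hh.integrable_of_hasCompactSupport (HasCompactSupport.of_compactSpace h)

theorem eq_zero_of_integral_eq_zero [μ.IsOpenPosMeasure] {h : X → ℝ} (hh : Continuous h)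
    (h0 : 0 ≤ h) (hi : ∫ x, h x ∂μ = 0) : h = 0 :=
  (hh.ae_eq_iff_eq μ continuous_zero).1
    ((integral_eq_zero_iff_of_nonneg h0 (integrable_of_continuous hh)).1 hi)

variable {E E' : Type*} [NormedAddCommGroup E] [InnerProductSpace ℝ E] [FiniteDimensional ℝ E]
  [MeasurableSpace E] [BorelSpace E] [NormedAddCommGroup E'] [InnerProductSpace ℝ E']
  [FiniteDimensional ℝ E'] [MeasurableSpace E'] [BorelSpace E']

variable (E) in
/-- The surface measure on the unit sphere of a Euclidean space; `surf n` is the case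
`E = ℝⁿ⁺¹`. -/
noncomputable abbrev surfaceMeasure : Measure (UnitSphere E) := (volume : Measure E).toSphere

open scoped Pointwise in
theorem measurePreserving_sphereIsometry (L : E ≃ₗᵢ[ℝ] E') :
    MeasurePreserving (sphereIsometry L) (surfaceMeasure E) (surfaceMeasure E') := by
  have hL : Measurable (sphereIsometry L) := (sphereIsometry L).continuous.measurable
  refine ⟨hL, Measure.ext fun s hs => ?_⟩
  have hbase : L '' ((↑) '' (sphereIsometry L ⁻¹' s)) = (↑) '' s := by
    conv_rhs => rw [← image_preimage_eq s (sphereIsometry L).surjective, image_image]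
    exact image_image _ _ _
  have hcone : L '' (Ioo (0 : ℝ) 1 • ((↑) '' (sphereIsometry L ⁻¹' s))) =
      Ioo (0 : ℝ) 1 • ((↑) '' s) := by
    rw [← image2_smul, image_image2_distrib_right fun r x => map_smul L r x, hbase, image2_smul]
  have hvol (t : Set E) : volume (L '' t) = volume t := by
    rw [L.image_eq_preimage_symm]
    exact L.symm.measurePreserving.measure_preimage_equiv (f := L.symm.toMeasurableEquiv) t
  rw [Measure.map_apply hL hs, Measure.toSphere_apply' _ hs, Measure.toSphere_apply' _ (hL hs),
    ← hcone, hvol, L.toLinearEquiv.finrank_eq]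

theorem measurePreserving_reflect (v : E) :
    MeasurePreserving (reflect v) (surfaceMeasure E) (surfaceMeasure E) :=
  measurePreserving_sphereIsometry _

theorem integral_comp_reflect (v : E) (h : UnitSphere E → ℝ) :
    ∫ x, h (reflect v x) ∂surfaceMeasure E = ∫ x, h x ∂surfaceMeasure E :=
  (measurePreserving_reflect v).integral_comp (reflect v).toHomeomorph.measurableEmbedding h

theorem integral_add_comp_reflect (v : E) {h : UnitSphere E → ℝ} (hh : Continuous h) :
    ∫ x, (h x + h (reflect v x)) ∂surfaceMeasure E = 2 * ∫ x, h x ∂surfaceMeasure E := by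
  have hr := integrable_of_continuous (μ := surfaceMeasure E) (hh.comp (reflect v).continuous)
  rw [two_mul, ← integral_comp_reflect v h]
  exact (integral_add (integrable_of_continuous hh) hr).trans
    (congrArg (· + _) (integral_comp_reflect v h).symm)

end SurfaceMeasure

section Polarization

variable {E : Type*} [NormedAddCommGroup E] [InnerProductSpace ℝ E]

/-- The two-point symmetrization (polarization) of `F` towards the half-space `0 ≤ ⟪·, v⟫`: of the
values of `F` at two points exchanged by `reflect v`, the larger one goes to that half-space. -/
noncomputable def polarize (v : E) (F : C(UnitSphere E, ℝ)) : C(UnitSphere E, ℝ) where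
  toFun x := if 0 ≤ ⟪(x : E), v⟫ then max (F x) (F (reflect v x)) else min (F x) (F (reflect v x))
  continuous_toFun := by
    have hr := (reflect v).continuous
    refine Continuous.if_le (by fun_prop) (by fun_prop) continuous_const (by fun_prop) ?_
    intro x hx
    rw [reflect_eq_self hx.symm, max_self, min_self]

/-- `F` is at least as large on the half-space `0 < ⟪·, v⟫` as at the reflected points; these
are the functions fixed by `polarize v`. -/
def IsPolarized (F : UnitSphere E → ℝ) (v : E) : Prop :=
  ∀ x : UnitSphere E, 0 < ⟪(x : E), v⟫ → F (reflect v x) ≤ F x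

variable {v : E} (F : C(UnitSphere E, ℝ)) {x : UnitSphere E}

theorem polarize_of_nonneg (h : 0 ≤ ⟪(x : E), v⟫) :
    polarize v F x = max (F x) (F (reflect v x)) :=
  if_pos h

theorem polarize_of_nonpos (h : ⟪(x : E), v⟫ ≤ 0) :
    polarize v F x = min (F x) (F (reflect v x)) := by
  rcases h.lt_or_eq with h | h
  · exact if_neg h.not_ge
  · rw [polarize_of_nonneg F h.ge, reflect_eq_self h, max_self, min_self]

theorem polarize_reflect_of_nonneg (h : 0 ≤ ⟪(x : E), v⟫) :
    polarize v F (reflect v x) = min (F x) (F (reflect v x)) := by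
  rw [polarize_of_nonpos F (by simpa using h), reflect_reflect, min_comm]

theorem isPolarized_of_polarize_eq
    (h : ∀ x : UnitSphere E, 0 < ⟪(x : E), v⟫ → polarize v F x = F x) : IsPolarized F v := by
  intro x hx
  rw [← h x hx, polarize_of_nonneg F hx.le]
  exact le_max_right _ _

theorem comp_polarize_add_comp_polarize_reflect {M : Type*} [AddCommMagma M] (φ : ℝ → M)
    (x : UnitSphere E) :
    φ (polarize v F x) + φ (polarize v F (reflect v x)) = φ (F x) + φ (F (reflect v x)) := by
  rcases le_total 0 ⟪(x : E), v⟫ with h | h <;>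
    rcases le_total (F x) (F (reflect v x)) with h' | h' <;>
    simp [polarize_of_nonneg, polarize_of_nonpos, h, h', add_comm]

theorem polarize_sub_mul_nonneg {u : E} (huv : 0 < ⟪u, v⟫) (x : UnitSphere E) :
    0 ≤ (polarize v F x - F x) * (⟪(x : E), u⟫ - ⟪(reflect v x : E), u⟫) := by
  rw [inner_sub_inner_reflect]
  rcases le_total 0 ⟪(x : E), v⟫ with h | h
  · rw [polarize_of_nonneg F h]
    exact mul_nonneg (sub_nonneg.2 (le_max_left _ _)) (by positivity)
  · rw [polarize_of_nonpos F h]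
    refine mul_nonneg_of_nonpos_of_nonpos (sub_nonpos.2 (min_le_left _ _))
      (div_nonpos_of_nonpos_of_nonneg ?_ (by positivity))
    exact mul_nonpos_of_nonneg_of_nonpos zero_le_two (mul_nonpos_of_nonpos_of_nonneg h huv.le)

theorem IsPolarized.sub_mul_inner_nonneg {F : UnitSphere E → ℝ} (hF : IsPolarized F v)
    (x : UnitSphere E) : 0 ≤ (F x - F (reflect v x)) * ⟪(x : E), v⟫ := by
  rcases lt_trichotomy 0 ⟪(x : E), v⟫ with hx | hx | hx
  · exact mul_nonneg (sub_nonneg.2 (hF x hx)) hx.le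
  · rw [← hx, mul_zero]
  · have hle := hF (reflect v x) (by simpa using hx)
    rw [reflect_reflect] at hle
    exact mul_nonneg_of_nonpos_of_nonpos (sub_nonpos.2 hle) hx.le

theorem polarize_eq_or (v : E) (x : UnitSphere E) :
    polarize v F x = F x ∨ polarize v F x = F (reflect v x) :=
  (le_total 0 ⟪(x : E), v⟫).elim (fun h => polarize_of_nonneg F h ▸ max_choice _ _)
    fun h => polarize_of_nonpos F h ▸ min_choice _ _

/-- Points at distance at most `δ` are mapped to values at distance at most `ε`; the pairs `(δ, ε)`
with this property encode the modulus of continuity of `F`. -/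
def OscillationLE {X : Type*} [PseudoMetricSpace X] (F : X → ℝ) (δ ε : ℝ) : Prop :=
  ∀ x y, dist x y ≤ δ → |F x - F y| ≤ ε

theorem OscillationLE.polarize {F : C(UnitSphere E, ℝ)} {δ ε : ℝ} (hF : OscillationLE F δ ε)
    (v : E) : OscillationLE (polarize v F) δ ε := by
  intro x y hxy
  have hxy' : |F (reflect v x) - F (reflect v y)| ≤ ε := hF _ _ (by rwa [(reflect v).dist_eq])
  rcases le_total 0 (⟪(x : E), v⟫ * ⟪(y : E), v⟫) with hside | hside
  · rcases mul_nonneg_iff.1 hside with ⟨hx, hy⟩ | ⟨hx, hy⟩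
    · rw [polarize_of_nonneg F hx, polarize_of_nonneg F hy]
      exact (abs_max_sub_max_le_max _ _ _ _).trans (max_le (hF x y hxy) hxy')
    · rw [polarize_of_nonpos F hx, polarize_of_nonpos F hy]
      exact (abs_min_sub_min_le_max _ _ _ _).trans (max_le (hF x y hxy) hxy')
  · -- reflecting one of two points on different sides of `vᗮ` brings them closer
    have hd : dist (reflect v x) y ≤ δ := by
      refine (dist_le_dist_reflect (v := v) ?_).trans (by rwa [reflect_reflect])
      rwa [inner_reflect_self, neg_mul, neg_nonneg]
    have hd' : dist x (reflect v y) ≤ δ := by rwa [← (reflect v).dist_eq, reflect_reflect]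
    rcases polarize_eq_or F v x with hx | hx <;> rcases polarize_eq_or F v y with hy | hy <;>
      rw [hx, hy]
    exacts [hF x y hxy, hF _ _ hd', hF _ _ hd, hxy']

variable [FiniteDimensional ℝ E]

theorem norm_polarize_le (v : E) : ‖polarize v F‖ ≤ ‖F‖ :=
  (ContinuousMap.norm_le _ (norm_nonneg F)).2 fun x =>
    (polarize_eq_or F v x).elim (fun h => h ▸ F.norm_coe_le_norm _)
      fun h => h ▸ F.norm_coe_le_norm _

variable [MeasurableSpace E] [BorelSpace E]

theorem integral_comp_polarize (v : E) {φ : ℝ → ℝ} (hφ : Continuous φ) :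
    ∫ x, φ (polarize v F x) ∂surfaceMeasure E = ∫ x, φ (F x) ∂surfaceMeasure E := by
  have hP := integral_add_comp_reflect v (hφ.comp (polarize v F).continuous)
  have hF := integral_add_comp_reflect v (hφ.comp F.continuous)
  simp only [Function.comp_apply, comp_polarize_add_comp_polarize_reflect] at hP hF
  linarith

end Polarization

section WeightedIntegral

variable {X W : Type*} [TopologicalSpace X] [CompactSpace X] [MeasurableSpace X]
  [OpensMeasurableSpace X] {μ : Measure X} [NormedAddCommGroup W] [NormedSpace ℝ W] {w : X → W}

theorem integrable_continuousMap_smul (hw : Integrable w μ) (H : C(X, ℝ)) :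
    Integrable (fun x => H x • w x) μ :=
  hw.bdd_smul ‖H‖ H.continuous.aestronglyMeasurable (.of_forall H.norm_coe_le_norm)

theorem continuous_integral_continuousMap_smul (hw : Integrable w μ) :
    Continuous fun H : C(X, ℝ) => ∫ x, H x • w x ∂μ := by
  refine (LipschitzWith.of_dist_le' (K := ∫ x, ‖w x‖ ∂μ) fun H H' => ?_).continuous
  rw [dist_eq_norm, ← integral_sub (integrable_continuousMap_smul hw H)
    (integrable_continuousMap_smul hw H'), mul_comm, ← integral_const_mul]
  refine norm_integral_le_of_norm_le (hw.norm.const_mul _) (.of_forall fun x => ?_)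
  rw [← sub_smul, norm_smul, dist_eq_norm]
  gcongr
  exact (H - H').norm_coe_le_norm x

end WeightedIntegral

section RieszForm

variable {E : Type*} [NormedAddCommGroup E] [InnerProductSpace ℝ E] {k : ℝ → ℝ}

/-- The integrand of the Riesz functional `rieszForm`, as a function on pairs of points. -/
noncomputable def rieszIntegrand (k : ℝ → ℝ) (F G : UnitSphere E → ℝ)
    (p : UnitSphere E × UnitSphere E) : ℝ :=
  k ⟪(p.1 : E), p.2⟫ * F p.1 * G p.2

/-- The sum of `H` over the orbit of a pair of points under reflecting either of them. For Riesz
integrands, polarization increases this sum pointwise, though not the integrand itself. -/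
noncomputable def orbitSum (v : E) (H : UnitSphere E × UnitSphere E → ℝ)
    (p : UnitSphere E × UnitSphere E) : ℝ :=
  H p + H (reflect v p.1, reflect v p.2) + (H (p.1, reflect v p.2) + H (reflect v p.1, p.2))

theorem orbitSum_reflect_left (v : E) (H : UnitSphere E × UnitSphere E → ℝ) (x y : UnitSphere E) :
    orbitSum v H (reflect v x, y) = orbitSum v H (x, y) := by
  simp only [orbitSum, reflect_reflect]
  ring

theorem orbitSum_reflect_right (v : E) (H : UnitSphere E × UnitSphere E → ℝ)
    (x y : UnitSphere E) : orbitSum v H (x, reflect v y) = orbitSum v H (x, y) := by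
  simp only [orbitSum, reflect_reflect]
  ring

theorem two_mul_orbitSum_rieszIntegrand (v : E) (F G : UnitSphere E → ℝ) (x y : UnitSphere E) :
    2 * orbitSum v (rieszIntegrand k F G) (x, y) =
      (k ⟪(x : E), y⟫ + k ⟪(reflect v x : E), y⟫) *
          ((F x + F (reflect v x)) * (G y + G (reflect v y))) +
        (k ⟪(x : E), y⟫ - k ⟪(reflect v x : E), y⟫) *
          ((F x - F (reflect v x)) * (G y - G (reflect v y))) := by
  simp only [orbitSum, rieszIntegrand, inner_reflect_right, reflect_reflect]
  ring

theorem two_mul_orbitSum_polarize_sub {v : E} (F G : C(UnitSphere E, ℝ)) {x y : UnitSphere E}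
    (hx : 0 ≤ ⟪(x : E), v⟫) (hy : 0 ≤ ⟪(y : E), v⟫) :
    2 * (orbitSum v (rieszIntegrand k (polarize v F) (polarize v G)) (x, y) -
        orbitSum v (rieszIntegrand k F G) (x, y)) =
      (k ⟪(x : E), y⟫ - k ⟪(reflect v x : E), y⟫) *
        (|(F x - F (reflect v x)) * (G y - G (reflect v y))| -
          (F x - F (reflect v x)) * (G y - G (reflect v y))) := by
  rw [mul_sub, two_mul_orbitSum_rieszIntegrand, two_mul_orbitSum_rieszIntegrand,
    polarize_of_nonneg F hx, polarize_reflect_of_nonneg F hx, polarize_of_nonneg G hy,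
    polarize_reflect_of_nonneg G hy, max_add_min, max_add_min, max_sub_min_eq_abs',
    max_sub_min_eq_abs', abs_mul]
  ring

theorem orbitSum_le_orbitSum_polarize (hk : MonotoneOn k (Icc (-1) 1)) (v : E)
    (F G : C(UnitSphere E, ℝ)) :
    orbitSum v (rieszIntegrand k F G) ≤
      orbitSum v (rieszIntegrand k (polarize v F) (polarize v G)) := by
  have hquad {x y : UnitSphere E} (hx : 0 ≤ ⟪(x : E), v⟫) (hy : 0 ≤ ⟪(y : E), v⟫) :
      orbitSum v (rieszIntegrand k F G) (x, y) ≤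
        orbitSum v (rieszIntegrand k (polarize v F) (polarize v G)) (x, y) := by
    have hk' := hk (inner_mem_Icc _ _) (inner_mem_Icc _ _)
      (inner_reflect_le_inner (mul_nonneg hx hy))
    have := two_mul_orbitSum_polarize_sub (k := k) F G hx hy
    have := mul_nonneg (sub_nonneg.2 hk')
      (sub_nonneg.2 (le_abs_self ((F x - F (reflect v x)) * (G y - G (reflect v y)))))
    linarith
  rintro ⟨x, y⟩
  wlog hx : 0 ≤ ⟪(x : E), v⟫ generalizing x
  · simpa only [orbitSum_reflect_left] using this (reflect v x) (by simpa using (not_le.1 hx).le)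
  wlog hy : 0 ≤ ⟪(y : E), v⟫ generalizing y
  · simpa only [orbitSum_reflect_right] using this (reflect v y) (by simpa using (not_le.1 hy).le)
  exact hquad hx hy

theorem mul_nonneg_of_orbitSum_polarize_eq (hk : StrictMonoOn k (Icc (-1) 1)) {v : E}
    {F G : C(UnitSphere E, ℝ)} {x y : UnitSphere E} (hx : 0 < ⟪(x : E), v⟫)
    (hy : 0 < ⟪(y : E), v⟫) (h : orbitSum v (rieszIntegrand k F G) (x, y) =
      orbitSum v (rieszIntegrand k (polarize v F) (polarize v G)) (x, y)) :
    0 ≤ (F x - F (reflect v x)) * (G y - G (reflect v y)) := by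
  have hk' := hk (inner_mem_Icc _ _) (inner_mem_Icc _ _) (inner_reflect_lt_inner (mul_pos hx hy))
  have hdiff := two_mul_orbitSum_polarize_sub (k := k) F G hx.le hy.le
  rw [h, sub_self, mul_zero, eq_comm, mul_eq_zero, or_iff_right (sub_pos.2 hk').ne', sub_eq_zero]
    at hdiff
  exact abs_eq_self.1 hdiff

theorem rieszIntegrand_eq_smul (F G : C(UnitSphere E, ℝ)) :
    rieszIntegrand k F G = fun p : UnitSphere E × UnitSphere E =>
      (F.comp .fst * G.comp .snd : C(UnitSphere E × UnitSphere E, ℝ)) p •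
        k ⟪(p.1 : E), p.2⟫ := by
  funext p
  change k ⟪(p.1 : E), p.2⟫ * F p.1 * G p.2 = F p.1 * G p.2 * k ⟪(p.1 : E), p.2⟫
  ring

variable [FiniteDimensional ℝ E] [MeasurableSpace E] [BorelSpace E]

/-- The functional `∬ k (x · y) F x G y` of the Riesz rearrangement inequality. -/
noncomputable def rieszForm (k : ℝ → ℝ) (F G : UnitSphere E → ℝ) : ℝ :=
  ∫ y, ∫ x, k ⟪(x : E), y⟫ * F x * G y ∂surfaceMeasure E ∂surfaceMeasure E

theorem integrable_kernel (hk : MonotoneOn k (Icc (-1) 1)) :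
    Integrable (fun p : UnitSphere E × UnitSphere E => k ⟪(p.1 : E), p.2⟫)
      ((surfaceMeasure E).prod (surfaceMeasure E)) := by
  have hmeas : Measurable fun p : UnitSphere E × UnitSphere E => k ⟪(p.1 : E), p.2⟫ := by
    have hkm : Monotone fun t : Icc (-1 : ℝ) 1 => k t := fun s t hst => hk s.2 t.2 hst
    have hinner : Continuous fun p : UnitSphere E × UnitSphere E =>
        (⟨⟪(p.1 : E), p.2⟫, inner_mem_Icc _ _⟩ : Icc (-1 : ℝ) 1) := by fun_prop
    exact hkm.measurable.comp hinner.measurable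
  have hone : (-1 : ℝ) ≤ 1 := by norm_num
  refine .of_bound hmeas.aestronglyMeasurable (max |k (-1)| |k 1|) (.of_forall fun p => ?_)
  have ht := inner_mem_Icc p.1 p.2
  exact abs_le_max_abs_abs (hk (left_mem_Icc.2 hone) ht ht.1) (hk ht (right_mem_Icc.2 hone) ht.2)

theorem integrable_rieszIntegrand (hk : MonotoneOn k (Icc (-1) 1)) (F G : C(UnitSphere E, ℝ)) :
    Integrable (rieszIntegrand k F G) ((surfaceMeasure E).prod (surfaceMeasure E)) :=
  rieszIntegrand_eq_smul (k := k) F G ▸ integrable_continuousMap_smul (integrable_kernel hk) _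

theorem rieszForm_eq_integral_prod (hk : MonotoneOn k (Icc (-1) 1)) (F G : C(UnitSphere E, ℝ)) :
    rieszForm k F G =
      ∫ p, rieszIntegrand k F G p ∂(surfaceMeasure E).prod (surfaceMeasure E) :=
  (integral_prod_symm _ (integrable_rieszIntegrand hk F G)).symm

theorem continuous_rieszForm (hk : MonotoneOn k (Icc (-1) 1)) :
    Continuous fun p : C(UnitSphere E, ℝ) × C(UnitSphere E, ℝ) => rieszForm k p.1 p.2 := by
  have hprod : Continuous fun p : C(UnitSphere E, ℝ) × C(UnitSphere E, ℝ) =>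
      (p.1.comp .fst * p.2.comp .snd : C(UnitSphere E × UnitSphere E, ℝ)) :=
    ((ContinuousMap.continuous_precomp _).comp continuous_fst).mul
      ((ContinuousMap.continuous_precomp _).comp continuous_snd)
  simp only [rieszForm_eq_integral_prod hk, rieszIntegrand_eq_smul]
  exact (continuous_integral_continuousMap_smul (integrable_kernel hk)).comp hprod

theorem integrable_orbitSum (v : E) {H : UnitSphere E × UnitSphere E → ℝ}
    (hH : Integrable H ((surfaceMeasure E).prod (surfaceMeasure E))) :
    Integrable (orbitSum v H) ((surfaceMeasure E).prod (surfaceMeasure E)) := by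
  have hr := measurePreserving_reflect v
  have hid := MeasurePreserving.id (surfaceMeasure E)
  exact (hH.add ((hr.prod hr).integrable_comp_of_integrable hH)).add
    (((hid.prod hr).integrable_comp_of_integrable hH).add
      ((hr.prod hid).integrable_comp_of_integrable hH))

theorem integral_orbitSum (v : E) {H : UnitSphere E × UnitSphere E → ℝ}
    (hH : Integrable H ((surfaceMeasure E).prod (surfaceMeasure E))) :
    ∫ p, orbitSum v H p ∂(surfaceMeasure E).prod (surfaceMeasure E) =
      4 * ∫ p, H p ∂(surfaceMeasure E).prod (surfaceMeasure E) := by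
  set σ := (surfaceMeasure E).prod (surfaceMeasure E)
  have hr := measurePreserving_reflect v
  have hid := MeasurePreserving.id (surfaceMeasure E)
  have hcomp {T : UnitSphere E × UnitSphere E → UnitSphere E × UnitSphere E}
      (hT : MeasurePreserving T σ σ) :
      Integrable (fun p => H (T p)) σ ∧ ∫ p, H (T p) ∂σ = ∫ p, H p ∂σ :=
    ⟨hT.integrable_comp_of_integrable hH, by
      rw [← integral_map hT.aemeasurable (hT.map_eq.symm ▸ hH.1), hT.map_eq]⟩
  obtain ⟨hi₁, he₁⟩ := hcomp (hr.prod hr)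
  obtain ⟨hi₂, he₂⟩ := hcomp (hid.prod hr)
  obtain ⟨hi₃, he₃⟩ := hcomp (hr.prod hid)
  have hsum : ∫ p, orbitSum v H p ∂σ =
      ∫ p, H p + H (Prod.map (reflect v) (reflect v) p) ∂σ +
        ∫ p, H (Prod.map id (reflect v) p) + H (Prod.map (reflect v) id p) ∂σ :=
    integral_add (hH.add hi₁) (hi₂.add hi₃)
  rw [hsum, integral_add hH hi₁, integral_add hi₂ hi₃, he₁, he₂, he₃]
  ring

theorem integral_orbitSum_rieszIntegrand (hk : MonotoneOn k (Icc (-1) 1)) (v : E)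
    (F G : C(UnitSphere E, ℝ)) :
    ∫ p, orbitSum v (rieszIntegrand k F G) p ∂(surfaceMeasure E).prod (surfaceMeasure E) =
      4 * rieszForm k F G := by
  rw [integral_orbitSum v (integrable_rieszIntegrand hk F G), rieszForm_eq_integral_prod hk]

theorem rieszForm_le_rieszForm_polarize (hk : MonotoneOn k (Icc (-1) 1)) (v : E)
    (F G : C(UnitSphere E, ℝ)) :
    rieszForm k F G ≤ rieszForm k (polarize v F) (polarize v G) := by
  have hmono := integral_mono (integrable_orbitSum v (integrable_rieszIntegrand hk F G))
    (integrable_orbitSum v (integrable_rieszIntegrand hk (polarize v F) (polarize v G)))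
    (orbitSum_le_orbitSum_polarize hk v F G)
  rw [integral_orbitSum_rieszIntegrand hk, integral_orbitSum_rieszIntegrand hk] at hmono
  linarith

theorem mul_nonneg_of_rieszForm_polarize_eq (hk : StrictMonoOn k (Icc (-1) 1)) {v : E}
    {F G : C(UnitSphere E, ℝ)} (heq : rieszForm k F G = rieszForm k (polarize v F) (polarize v G))
    {x y : UnitSphere E} (hx : 0 < ⟪(x : E), v⟫) (hy : 0 < ⟪(y : E), v⟫) :
    0 ≤ (F x - F (reflect v x)) * (G y - G (reflect v y)) := by
  have hkm := hk.monotoneOn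
  have hae := (integral_eq_iff_of_ae_le (integrable_orbitSum v (integrable_rieszIntegrand hkm F G))
    (integrable_orbitSum v (integrable_rieszIntegrand hkm (polarize v F) (polarize v G)))
    (.of_forall (orbitSum_le_orbitSum_polarize hkm v F G))).1 (by
      rw [integral_orbitSum_rieszIntegrand hkm, integral_orbitSum_rieszIntegrand hkm, heq])
  by_contra! hneg
  have hr := (reflect v).continuous
  have hopen : IsOpen {p : UnitSphere E × UnitSphere E | 0 < ⟪(p.1 : E), v⟫ ∧ 0 < ⟪(p.2 : E), v⟫ ∧
      (F p.1 - F (reflect v p.1)) * (G p.2 - G (reflect v p.2)) < 0} :=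
    .and (isOpen_lt continuous_const (by fun_prop))
      (.and (isOpen_lt continuous_const (by fun_prop)) (isOpen_lt (by fun_prop) continuous_const))
  obtain ⟨⟨x', y'⟩, ⟨hx', hy', hneg'⟩, heq'⟩ :=
    (Measure.dense_of_ae hae).inter_open_nonempty _ hopen ⟨(x, y), hx, hy, hneg⟩
  exact hneg'.not_ge (mul_nonneg_of_orbitSum_polarize_eq hk hx' hy' heq')

end RieszForm

section Rearrangement

theorem identDistrib_iff_forall_integral_comp_eq {X Y : Type*} [MeasurableSpace X]
    [MeasurableSpace Y] {μ : Measure X} {ν : Measure Y} [IsFiniteMeasure μ] [IsFiniteMeasure ν]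
    {f : X → ℝ} {g : Y → ℝ} (hf : AEMeasurable f μ) (hg : AEMeasurable g ν) :
    ProbabilityTheory.IdentDistrib f g μ ν ↔
      ∀ φ : ℝ →ᵇ ℝ, ∫ x, φ (f x) ∂μ = ∫ y, φ (g y) ∂ν := by
  refine ⟨fun h φ => (h.comp φ.continuous.measurable).integral_eq, fun h => ⟨hf, hg, ?_⟩⟩
  refine ext_of_forall_integral_eq_of_IsFiniteMeasure fun φ => ?_
  rw [integral_map hf φ.continuous.aestronglyMeasurable,
    integral_map hg φ.continuous.aestronglyMeasurable, h φ]

variable {X : Type*} [PseudoMetricSpace X] [CompactSpace X] [MeasurableSpace X]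

/-- `F` is a rearrangement of `f` whose norm and modulus of continuity are at most those of `f`.
Unlike the set of all continuous rearrangements of `f`, the set of these is compact. -/
structure IsTameRearrangement (μ : Measure X) (f F : C(X, ℝ)) : Prop where
  norm_le : ‖F‖ ≤ ‖f‖
  oscillationLE : ∀ δ ε, OscillationLE f δ ε → OscillationLE F δ ε
  identDistrib : ProbabilityTheory.IdentDistrib F f μ μ

variable [BorelSpace X] (μ : Measure X) (f : C(X, ℝ))

theorem IsTameRearrangement.refl : IsTameRearrangement μ f f :=
  ⟨le_rfl, fun _ _ h => h, .refl f.continuous.aemeasurable⟩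

variable [IsFiniteMeasure μ]

theorem isClosed_setOf_isTameRearrangement : IsClosed {F | IsTameRearrangement μ f F} := by
  have heval (x : X) : Continuous fun F : C(X, ℝ) => F x := continuous_eval_const x
  have hosc : IsClosed {F : C(X, ℝ) | ∀ δ ε, OscillationLE f δ ε → OscillationLE F δ ε} := by
    simp only [OscillationLE, ofPred_forall]
    exact isClosed_iInter fun δ => isClosed_iInter fun ε => isClosed_iInter fun _ =>
      isClosed_iInter fun x => isClosed_iInter fun y => isClosed_iInter fun _ =>
        isClosed_le ((heval x).sub (heval y)).abs continuous_const
  have hdistrib : IsClosed {F : C(X, ℝ) | ProbabilityTheory.IdentDistrib F f μ μ} := by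
    have hiff (F : C(X, ℝ)) := identDistrib_iff_forall_integral_comp_eq
      (μ := μ) (ν := μ) F.continuous.aemeasurable f.continuous.aemeasurable
    simp only [hiff, ofPred_forall]
    refine isClosed_iInter fun φ => isClosed_eq ?_ continuous_const
    exact continuous_of_dominated (bound := fun _ => ‖φ‖)
      (fun F => (φ.continuous.comp F.continuous).aestronglyMeasurable)
      (fun F => .of_forall fun x => φ.norm_coe_le_norm _) (integrable_const _)
      (.of_forall fun x => φ.continuous.comp (heval x))
  have hnorm : IsClosed {F : C(X, ℝ) | ‖F‖ ≤ ‖f‖} := isClosed_le continuous_norm continuous_const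
  exact isClosed_of_closure_subset fun F hF =>
    ⟨closure_minimal (fun _ h => h.norm_le) hnorm hF,
      closure_minimal (fun _ h => h.oscillationLE) hosc hF,
      closure_minimal (fun _ h => h.identDistrib) hdistrib hF⟩

theorem isCompact_setOf_isTameRearrangement : IsCompact {F | IsTameRearrangement μ f F} := by
  set e := ContinuousMap.isometryEquivBoundedOfCompact X ℝ
  rw [← e.symm.toHomeomorph.isCompact_preimage]
  refine BoundedContinuousFunction.arzela_ascoli₂ (Metric.closedBall 0 ‖f‖)
    (isCompact_closedBall _ _) _
    ((isClosed_setOf_isTameRearrangement μ f).preimage e.symm.continuous)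
    (fun F x hF => mem_closedBall_zero_iff.2 (((e.symm F).norm_coe_le_norm x).trans hF.norm_le))
    fun x => Metric.equicontinuousAt_iff.2 fun ε hε => ?_
  obtain ⟨δ, hδ, hf⟩ := Metric.uniformContinuous_iff.1
    (CompactSpace.uniformContinuous_of_continuous f.continuous) (ε / 2) (half_pos hε)
  have hosc : OscillationLE f (δ / 2) (ε / 2) := fun x y hxy =>
    (hf (hxy.trans_lt (half_lt_self hδ))).le
  refine ⟨δ / 2, half_pos hδ, fun y hy F => ?_⟩
  exact (F.2.oscillationLE _ _ hosc x y (dist_comm y x ▸ hy.le)).trans_lt (half_lt_self hε)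

end Rearrangement

section FirstMoment

variable {E : Type*} [NormedAddCommGroup E] [InnerProductSpace ℝ E] [FiniteDimensional ℝ E]
  [MeasurableSpace E] [BorelSpace E]

theorem IsTameRearrangement.polarize {f F : C(UnitSphere E, ℝ)}
    (h : IsTameRearrangement (surfaceMeasure E) f F) (v : E) :
    IsTameRearrangement (surfaceMeasure E) f (polarize v F) where
  norm_le := (norm_polarize_le F v).trans h.norm_le
  oscillationLE δ ε hf := (h.oscillationLE δ ε hf).polarize v
  identDistrib := by
    refine .trans ?_ h.identDistrib
    exact (identDistrib_iff_forall_integral_comp_eq (USphere.polarize v F).continuous.aemeasurable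
      F.continuous.aemeasurable).2 fun φ => integral_comp_polarize F v φ.continuous

/-- The first moment of `F` on the unit sphere. It points towards the pole when `F` is radially
decreasing, and polarization moves it into the half-space of the polarization. -/
noncomputable def firstMoment (F : UnitSphere E → ℝ) : E :=
  ∫ x, F x • (x : E) ∂surfaceMeasure E

theorem continuous_firstMoment : Continuous fun F : C(UnitSphere E, ℝ) => firstMoment F :=
  continuous_integral_continuousMap_smul (integrable_of_continuous continuous_subtype_val)

variable (F : C(UnitSphere E, ℝ)) {u v : E}

theorem inner_firstMoment (u : E) :
    ⟪firstMoment F, u⟫ = ∫ x, F x * ⟪(x : E), u⟫ ∂surfaceMeasure E := by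
  have hi : Integrable (fun x : UnitSphere E => F x • (x : E)) (surfaceMeasure E) :=
    integrable_of_continuous (by fun_prop)
  rw [real_inner_comm, firstMoment, ← integral_inner hi]
  simp only [inner_smul_right, real_inner_comm u]

theorem two_mul_inner_firstMoment (u v : E) :
    2 * ⟪firstMoment F, u⟫ = ∫ x, (F x * ⟪(x : E), u⟫ +
      F (reflect v x) * ⟪(reflect v x : E), u⟫) ∂surfaceMeasure E := by
  rw [inner_firstMoment]
  exact (integral_add_comp_reflect v (by fun_prop)).symm

theorem two_mul_inner_firstMoment_self (v : E) :
    2 * ⟪firstMoment F, v⟫ =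
      ∫ x, (F x - F (reflect v x)) * ⟪(x : E), v⟫ ∂surfaceMeasure E := by
  rw [two_mul_inner_firstMoment F v v]
  simp only [inner_reflect_self, mul_neg, ← sub_eq_add_neg, sub_mul]

theorem two_mul_inner_firstMoment_polarize_sub (u v : E) :
    2 * (⟪firstMoment (polarize v F), u⟫ - ⟪firstMoment F, u⟫) =
      ∫ x, (polarize v F x - F x) * (⟪(x : E), u⟫ - ⟪(reflect v x : E), u⟫)
        ∂surfaceMeasure E := by
  have hr := (reflect v).continuous
  rw [mul_sub, two_mul_inner_firstMoment _ u v, two_mul_inner_firstMoment F u v, ← integral_sub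
    (integrable_of_continuous (by fun_prop)) (integrable_of_continuous (by fun_prop))]
  congr 1
  funext x
  have hsum := comp_polarize_add_comp_polarize_reflect F id x (v := v)
  simp only [id] at hsum
  linear_combination ⟪(reflect v x : E), u⟫ * hsum

theorem inner_firstMoment_le_inner_firstMoment_polarize (huv : 0 < ⟪u, v⟫) :
    ⟪firstMoment F, u⟫ ≤ ⟪firstMoment (polarize v F), u⟫ := by
  have h : 0 ≤ 2 * (⟪firstMoment (polarize v F), u⟫ - ⟪firstMoment F, u⟫) := by
    rw [two_mul_inner_firstMoment_polarize_sub]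
    exact integral_nonneg (polarize_sub_mul_nonneg F huv)
  linarith

variable {F}

theorem isPolarized_of_inner_firstMoment_polarize_le (huv : 0 < ⟪u, v⟫)
    (h : ⟪firstMoment (polarize v F), u⟫ ≤ ⟪firstMoment F, u⟫) : IsPolarized F v := by
  have heq := h.antisymm (inner_firstMoment_le_inner_firstMoment_polarize F huv)
  have hdiff := two_mul_inner_firstMoment_polarize_sub F u v
  rw [heq, sub_self, mul_zero, eq_comm] at hdiff
  have hzero := eq_zero_of_integral_eq_zero (by fun_prop) (polarize_sub_mul_nonneg F huv) hdiff
  refine isPolarized_of_polarize_eq F fun x hx => sub_eq_zero.1 ?_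
  exact (mul_eq_zero.1 (congrFun hzero x)).resolve_right
    (sub_pos.2 (inner_reflect_lt_inner (mul_pos hx huv))).ne'

theorem IsPolarized.inner_firstMoment_nonneg (hF : IsPolarized F v) : 0 ≤ ⟪firstMoment F, v⟫ := by
  have h : 0 ≤ 2 * ⟪firstMoment F, v⟫ :=
    two_mul_inner_firstMoment_self F v ▸ integral_nonneg hF.sub_mul_inner_nonneg
  linarith

theorem IsPolarized.comp_reflect_eq (hF : IsPolarized F v) (h : ⟪firstMoment F, v⟫ = 0)
    (x : UnitSphere E) : F (reflect v x) = F x := by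
  have hr := (reflect v).continuous
  have hself := two_mul_inner_firstMoment_self F v
  rw [h, mul_zero, eq_comm] at hself
  have hzero := eq_zero_of_integral_eq_zero (by fun_prop) hF.sub_mul_inner_nonneg hself
  rcases mul_eq_zero.1 (congrFun hzero x) with hx | hx
  · exact (sub_eq_zero.1 hx).symm
  · rw [reflect_eq_self hx]

theorem exists_reflect_lt_of_inner_firstMoment_pos (h : 0 < ⟪firstMoment F, v⟫) :
    ∃ x : UnitSphere E, 0 < ⟪(x : E), v⟫ ∧ F (reflect v x) < F x := by
  by_contra! hle
  have hneg : IsPolarized (⇑(-F)) v := fun x hx => neg_le_neg (hle x hx)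
  have hnonneg := hneg.inner_firstMoment_nonneg
  rw [inner_firstMoment] at h hnonneg
  simp only [ContinuousMap.neg_apply, neg_mul, integral_neg] at hnonneg
  linarith

theorem exists_isTameRearrangement_forall_isPolarized {k : ℝ → ℝ} (hk : MonotoneOn k (Icc (-1) 1))
    (u : E) (f g : C(UnitSphere E, ℝ)) :
    ∃ F G, IsTameRearrangement (surfaceMeasure E) f F ∧ IsTameRearrangement (surfaceMeasure E) g G ∧
      (∀ v, 0 < ⟪u, v⟫ → IsPolarized F v ∧ IsPolarized G v) ∧
      rieszForm k f g ≤ rieszForm k F G := by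
  set A := {F | IsTameRearrangement (surfaceMeasure E) f F} ×ˢ
    {G | IsTameRearrangement (surfaceMeasure E) g G}
  have hA : IsCompact A := (isCompact_setOf_isTameRearrangement _ f).prod
    (isCompact_setOf_isTameRearrangement _ g)
  have hB : IsCompact (A ∩ {p | rieszForm k f g ≤ rieszForm k p.1 p.2}) :=
    hA.inter_right (isClosed_le continuous_const (continuous_rieszForm hk))
  have hJ : Continuous fun p : C(UnitSphere E, ℝ) × C(UnitSphere E, ℝ) =>
      ⟪firstMoment p.1, u⟫ + ⟪firstMoment p.2, u⟫ :=
    ((continuous_firstMoment.comp continuous_fst).inner continuous_const).add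
      ((continuous_firstMoment.comp continuous_snd).inner continuous_const)
  obtain ⟨⟨F, G⟩, ⟨⟨hF, hG⟩, hle⟩, hmax⟩ :=
    hB.exists_isMaxOn ⟨(f, g), ⟨.refl _ f, .refl _ g⟩, le_refl (rieszForm k f g)⟩ hJ.continuousOn
  refine ⟨F, G, hF, hG, fun v huv => ?_, hle⟩
  have hmax' : ⟪firstMoment (polarize v F), u⟫ + ⟪firstMoment (polarize v G), u⟫ ≤
      ⟪firstMoment F, u⟫ + ⟪firstMoment G, u⟫ :=
    hmax (a := (polarize v F, polarize v G))
      ⟨⟨hF.polarize v, hG.polarize v⟩, hle.trans (rieszForm_le_rieszForm_polarize hk v F G)⟩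
  have hFle := inner_firstMoment_le_inner_firstMoment_polarize F huv
  have hGle := inner_firstMoment_le_inner_firstMoment_polarize G huv
  exact ⟨isPolarized_of_inner_firstMoment_polarize_le huv (by linarith),
    isPolarized_of_inner_firstMoment_polarize_le huv (by linarith)⟩

end FirstMoment

section Symmetrization

variable {E : Type*} [NormedAddCommGroup E] [InnerProductSpace ℝ E]

theorem le_of_forall_isPolarized {F : UnitSphere E → ℝ} (hF : Continuous F) {u : E}
    (hu : u ≠ 0) (h : ∀ v, 0 < ⟪u, v⟫ → IsPolarized F v) {x y : UnitSphere E}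
    (hyx : ⟪(y : E), u⟫ ≤ ⟪(x : E), u⟫) : F y ≤ F x := by
  rcases eq_or_ne x y with rfl | hne
  · rfl
  have hne' : (x : E) - y ≠ 0 := sub_ne_zero.2 (Subtype.coe_injective.ne hne)
  -- `x - y` need not satisfy `0 < ⟪u, v⟫`, but its perturbations towards `u` do
  have hlim : Filter.Tendsto (fun t : ℝ => (x : E) - y + t • u) (𝓝[>] 0) (𝓝 ((x : E) - y)) := by
    have hcont : Continuous fun t : ℝ => (x : E) - y + t • u := by fun_prop
    simpa using (hcont.tendsto 0).mono_left nhdsWithin_le_nhds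
  have hrefl : Filter.Tendsto (fun t : ℝ => F (reflect ((x : E) - y + t • u) x)) (𝓝[>] 0)
      (𝓝 (F y)) := by
    have hcont := (continuousAt_reflect hne' x).tendsto
    rw [reflect_sub] at hcont
    exact (hF.tendsto y).comp (hcont.comp hlim)
  refine le_of_tendsto hrefl ?_
  have hx : ∀ᶠ t in 𝓝[>] (0 : ℝ), 0 < ⟪(x : E), x - y + t • u⟫ :=
    ((continuous_const.inner continuous_id).tendsto _ |>.comp hlim).eventually_const_lt
      (inner_sub_pos hne)
  filter_upwards [hx, self_mem_nhdsWithin] with t hxt ht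
  refine h _ ?_ x hxt
  have huu := mul_pos (mem_Ioi.1 ht) (real_inner_self_pos.2 hu)
  rw [inner_add_right, inner_sub_right, inner_smul_right, real_inner_comm, real_inner_comm (y : E)]
  linarith

theorem essInf_eq_of_forall_le {X : Type*} [TopologicalSpace X] [MeasurableSpace X]
    {μ : Measure X} [μ.IsOpenPosMeasure] {F : X → ℝ} (hF : Continuous F) {x₀ : X}
    (h : ∀ x, F x₀ ≤ F x) : essInf F μ = F x₀ := by
  have hset : {a | μ {x | F x < a} = 0} = Iic (F x₀) := by
    ext a
    refine ⟨fun ha => mem_Iic.2 (not_lt.1 fun hlt => ?_), fun ha => ?_⟩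
    · exact ((isOpen_lt hF continuous_const).measure_pos μ ⟨x₀, hlt⟩).ne' ha
    · exact measure_mono_null (fun x hx => (ha.trans (h x)).not_gt hx) measure_empty
  rw [essInf_eq_sSup, hset, csSup_Iic]

variable {n : ℕ}

theorem isRadialDecreasing_of_forall_isPolarized {F : C(USphere n, ℝ)} {u : USphere n}
    (hF : ∀ v, 0 < ⟪(u : EuclideanSpace ℝ (Fin (n + 1))), v⟫ → IsPolarized F v) :
    IsRadialDecreasing F u := by
  have hbdd : BddAbove (range F) := (isCompact_range F.continuous).bddAbove
  refine ⟨fun t => sSup (F '' {x | dot x u ≤ t}), fun s hs t _ hst => ?_, fun x => ?_⟩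
  · have hneg : dot (-u) u ≤ s := by simpa [dot] using hs.1
    exact csSup_le_csSup (hbdd.mono (image_subset_range _ _)) ⟨F (-u), -u, hneg, rfl⟩
      (image_mono fun x hx => le_trans hx hst)
  · have hmax : IsGreatest (F '' {y | dot y u ≤ dot x u}) (F x) :=
      ⟨mem_image_of_mem F (le_refl (dot x u)),
        forall_mem_image.2 fun y hy => le_of_forall_isPolarized F.continuous
          (ne_zero_of_mem_unit_sphere u) hF hy⟩
    exact hmax.csSup_eq.symm

theorem isSymmetrization_self {F : C(USphere n, ℝ)} (hF : IsRadialDecreasing F (north n)) :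
    IsSymmetrization F F where
  radial := hF
  measure_lt _ := rfl
  lsc := F.continuous.lowerSemicontinuous.lowerSemicontinuousOn _
  south_eq := by
    obtain ⟨φ, hφ, hFφ⟩ := hF
    refine (essInf_eq_of_forall_le F.continuous fun x => ?_).symm
    rw [hFφ, hFφ, dot_north_eq_neg_one.2 rfl]
    exact hφ (left_mem_Icc.2 (by norm_num)) (dot_mem_Icc _ _) (dot_mem_Icc _ _).1

theorem IsSymmetrization.congr {f g F : USphere n → ℝ} (hF : IsSymmetrization f F)
    (h : ProbabilityTheory.IdentDistrib f g (surf n) (surf n)) : IsSymmetrization g F where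
  radial := hF.radial
  measure_lt t := (h.measure_mem_eq measurableSet_Ioi).symm.trans (hF.measure_lt t)
  lsc := hF.lsc
  south_eq := by
    have hlt (a : ℝ) : surf n {x | f x < a} = surf n {x | g x < a} :=
      h.measure_mem_eq measurableSet_Iio
    simp only [hF.south_eq, essInf_eq_sSup, hlt]

theorem symmetrization_congr (hn : 1 ≤ n) {f g : C(USphere n, ℝ)}
    (h : ProbabilityTheory.IdentDistrib f g (surf n) (surf n)) :
    symmetrization hn f = symmetrization hn g :=
  ((isSymmetrization_symmetrization hn f).congr h).unique hn
    (isSymmetrization_symmetrization hn g)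

theorem symmetrization_eq_self (hn : 1 ≤ n) {F : C(USphere n, ℝ)}
    (hF : IsRadialDecreasing F (north n)) : symmetrization hn F = F :=
  (isSymmetrization_symmetrization hn F).unique hn (isSymmetrization_self hF)

theorem symmetrization_polarize (hn : 1 ≤ n) (f : C(USphere n, ℝ))
    (v : EuclideanSpace ℝ (Fin (n + 1))) :
    symmetrization hn (polarize v f) = symmetrization hn f :=
  symmetrization_congr hn ((IsTameRearrangement.refl (surf n) f).polarize v).identDistrib

theorem rieszForm_le_rieszForm_symmetrization (hn : 1 ≤ n) {k : ℝ → ℝ}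
    (hk : MonotoneOn k (Icc (-1) 1)) (f g : C(USphere n, ℝ)) :
    rieszForm k f g ≤ rieszForm k (symmetrization hn f) (symmetrization hn g) := by
  obtain ⟨F, G, hF, hG, hpol, hle⟩ := exists_isTameRearrangement_forall_isPolarized hk
    (north n : EuclideanSpace ℝ (Fin (n + 1))) f g
  rwa [← symmetrization_congr hn hF.identDistrib, ← symmetrization_congr hn hG.identDistrib,
    symmetrization_eq_self hn (isRadialDecreasing_of_forall_isPolarized fun v hv => (hpol v hv).1),
    symmetrization_eq_self hn (isRadialDecreasing_of_forall_isPolarized fun v hv => (hpol v hv).2)]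

end Symmetrization

section Rigidity

variable {E : Type*} [NormedAddCommGroup E] [InnerProductSpace ℝ E] {f g : UnitSphere E → ℝ}
  {U : Set E}

theorem exists_mem_inner_ne_zero (hU : IsOpen U) (hne : U.Nonempty) {z : E} (hz : z ≠ 0) :
    ∃ v ∈ U, ⟪z, v⟫ ≠ 0 := by
  by_contra! h
  have hsub : U ⊆ (ℝ ∙ z)ᗮ := fun v hv =>
    Submodule.mem_orthogonal_singleton_iff_inner_right.2 (h v hv)
  have htop := (ℝ ∙ z)ᗮ.eq_top_of_nonempty_interior' (hne.mono (interior_maximal hsub hU))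
  have hzz : z ∈ (ℝ ∙ z)ᗮ := htop ▸ Submodule.mem_top
  exact hz (inner_self_eq_zero.1 (Submodule.mem_orthogonal_singleton_iff_inner_right.1 hzz))

theorem eventually_eq_of_comp_reflect_eq {α : Type*} {F : UnitSphere E → α} (hU : IsOpen U)
    (h : ∀ v ∈ U, ∀ x, F (reflect v x) = F x) {v : E} (hv : v ∈ U) {z : UnitSphere E}
    (hzv : ⟪(z : E), v⟫ ≠ 0) : ∀ᶠ z' in 𝓝 z, F z' = F z := by
  have hv0 : ‖v‖ ≠ 0 := norm_ne_zero_iff.2 fun h0 => hzv (by rw [h0, inner_zero_right])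
  set c : ℝ := 2 * ⟪(z : E), v⟫ / ‖v‖ ^ 2 with hc
  have hc0 : c ≠ 0 := div_ne_zero (mul_ne_zero two_ne_zero hzv) (pow_ne_zero _ hv0)
  -- the points near `z` are also mapped to `reflect v z` by a reflection in `U`
  have hcont : Continuous fun z' : UnitSphere E => c⁻¹ • ((z' : E) - reflect v z) := by fun_prop
  have hz : c⁻¹ • ((z : E) - reflect v z) = v := by
    rw [coe_reflect, sub_sub_cancel, ← hc, inv_smul_smul₀ hc0]
  filter_upwards [hcont.continuousAt.eventually_mem (hU.mem_nhds (hz.symm ▸ hv))] with z' hz'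
  rw [← h _ hz' z', reflect_smul (inv_ne_zero hc0), reflect_sub, h v hv]

theorem eq_of_comp_reflect_eq (hE : 1 < Module.rank ℝ E) {α : Type*} {F : UnitSphere E → α}
    (hU : IsOpen U) (hne : U.Nonempty) (h : ∀ v ∈ U, ∀ x, F (reflect v x) = F x)
    (x y : UnitSphere E) : F x = F y := by
  have : PreconnectedSpace (UnitSphere E) :=
    Subtype.preconnectedSpace (isPreconnected_sphere hE 0 1)
  have hloc : IsLocallyConstant F := (IsLocallyConstant.iff_eventually_eq F).2 fun z => by
    obtain ⟨v, hv, hzv⟩ := exists_mem_inner_ne_zero hU hne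
      (ne_zero_of_mem_unit_sphere z)
    exact eventually_eq_of_comp_reflect_eq hU h hv hzv
  exact hloc.apply_eq_of_preconnectedSpace x y

/-- For every `v`, the differences of values of `f` and of `g` between a point of the half-space
`0 < ⟪·, v⟫` and its reflection all have the same sign. This is what equality in the Riesz
inequality forces. -/
def ReflectionAligned (f g : UnitSphere E → ℝ) : Prop :=
  ∀ ⦃v : E⦄ ⦃x y : UnitSphere E⦄, 0 < ⟪(x : E), v⟫ → 0 < ⟪(y : E), v⟫ →
    0 ≤ (f x - f (reflect v x)) * (g y - g (reflect v y))

theorem ReflectionAligned.symm (h : ReflectionAligned f g) : ReflectionAligned g f :=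
  fun _ _ _ hx hy => mul_comm (f _ - f _) _ ▸ h hy hx

theorem ReflectionAligned.isPolarized (h : ReflectionAligned f g) {v : E} {y : UnitSphere E}
    (hy : 0 < ⟪(y : E), v⟫) (hlt : g (reflect v y) < g y) : IsPolarized f v := fun _ hx =>
  sub_nonneg.1 (nonneg_of_mul_nonneg_left (h hx hy) (sub_pos.2 hlt))

theorem ReflectionAligned.exists_isOpen_isPolarized (h : ReflectionAligned f g) (hg : Continuous g)
    {y z : UnitSphere E} (hyz : g z < g y) :
    ∃ U : Set E, IsOpen U ∧ U.Nonempty ∧ ∀ v ∈ U, IsPolarized f v := by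
  have hne : y ≠ z := fun h => hyz.ne' (congrArg g h)
  have hpos : ∀ᶠ v in 𝓝 ((y : E) - z), 0 < ⟪(y : E), v⟫ :=
    (continuous_const.inner continuous_id).continuousAt.eventually_const_lt (inner_sub_pos hne)
  have hlt : ∀ᶠ v in 𝓝 ((y : E) - z), g (reflect v y) < g y := by
    have hcont := hg.continuousAt.comp
      (continuousAt_reflect (sub_ne_zero.2 (Subtype.coe_injective.ne hne)) y)
    exact hcont.eventually_lt_const (by simpa only [Function.comp_apply, reflect_sub] using hyz)
  obtain ⟨U, hU, hUo, hmem⟩ := eventually_nhds_iff.1 (hpos.and hlt)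
  exact ⟨U, hUo, ⟨_, hmem⟩, fun v hv => h.isPolarized (hU v hv).1 (hU v hv).2⟩

variable [FiniteDimensional ℝ E] [MeasurableSpace E] [BorelSpace E] {f g : C(UnitSphere E, ℝ)}

theorem ReflectionAligned.firstMoment_ne_zero (h : ReflectionAligned f g)
    (hE : 1 < Module.rank ℝ E) (hf : ¬ ∃ c, ∀ x, f x = c) (hg : ¬ ∃ c, ∀ x, g x = c) :
    firstMoment f ≠ 0 := by
  intro hzero
  obtain ⟨x₀⟩ : Nonempty (UnitSphere E) := not_isEmpty_iff.1 fun _ => hg ⟨0, isEmptyElim⟩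
  obtain ⟨y, z, hyz⟩ : ∃ y z, g z < g y := by
    by_contra! hle
    exact hg ⟨g x₀, fun x => (hle _ _).antisymm (hle _ _)⟩
  obtain ⟨U, hU, hne, hpol⟩ := h.exists_isOpen_isPolarized g.continuous hyz
  refine hf ⟨f x₀, fun x => eq_of_comp_reflect_eq hE hU hne (fun v hv => ?_) x x₀⟩
  exact (hpol v hv).comp_reflect_eq (by rw [hzero, inner_zero_left])

theorem ReflectionAligned.isPolarized_right (h : ReflectionAligned f g) {v : E}
    (hv : 0 < ⟪firstMoment f, v⟫) : IsPolarized g v := by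
  obtain ⟨x, hx, hlt⟩ := exists_reflect_lt_of_inner_firstMoment_pos hv
  exact h.symm.isPolarized hx hlt

theorem ReflectionAligned.sameRay_firstMoment (h : ReflectionAligned f g) :
    SameRay ℝ (firstMoment f) (firstMoment g) :=
  sameRay_of_forall_inner_nonneg fun _ hv => (h.isPolarized_right hv).inner_firstMoment_nonneg

theorem ReflectionAligned.exists_forall_isPolarized (h : ReflectionAligned f g)
    (hE : 1 < Module.rank ℝ E) (hf : ¬ ∃ c, ∀ x, f x = c) (hg : ¬ ∃ c, ∀ x, g x = c) :
    ∃ u : UnitSphere E, ∀ v, 0 < ⟪(u : E), v⟫ → IsPolarized f v ∧ IsPolarized g v := by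
  have hf0 := h.firstMoment_ne_zero hE hf hg
  obtain ⟨r, hr, hfg⟩ := h.sameRay_firstMoment.exists_pos_left hf0
    (h.symm.firstMoment_ne_zero hE hg hf)
  refine ⟨⟨‖firstMoment f‖⁻¹ • firstMoment f, by simp [norm_smul, hf0]⟩, fun v hv => ?_⟩
  have hfv : 0 < ⟪firstMoment f, v⟫ := by
    rw [real_inner_smul_left] at hv
    exact pos_of_mul_pos_right hv (inv_nonneg.2 (norm_nonneg _))
  have hgv : 0 < ⟪firstMoment g, v⟫ := by
    rw [← hfg, real_inner_smul_left]
    exact mul_pos hr hfv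
  exact ⟨h.symm.isPolarized_right hgv, h.isPolarized_right hfv⟩

end Rigidity

end USphere

theorem lemma3p3 {n : ℕ} (hn : 1 ≤ n) (k : ℝ → ℝ)
    (hk_bdd : ∃ C : ℝ, ∀ t ∈ Set.Icc (-1 : ℝ) 1, |k t| ≤ C)
    (hk_mono : StrictMonoOn k (Set.Icc (-1) 1))
    (f g : C(USphere n, ℝ))
    (hf : ¬ ∃ c : ℝ, ∀ x, f x = c) (hg : ¬ ∃ c : ℝ, ∀ x, g x = c)
    (heq : ∫ y, ∫ x, k (USphere.dot x y) * f x * g y ∂(USphere.surf n) ∂(USphere.surf n) =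
      ∫ y, ∫ x, k (USphere.dot x y) * USphere.symmetrization hn f x *
        USphere.symmetrization hn g y ∂(USphere.surf n) ∂(USphere.surf n)) :
    ∃ u : USphere n, USphere.IsRadialDecreasing f u ∧ USphere.IsRadialDecreasing g u := by
  have hrank : 1 < Module.rank ℝ (EuclideanSpace ℝ (Fin (n + 1))) := by
    rw [← Module.finrank_eq_rank, finrank_euclideanSpace_fin]
    exact_mod_cast Nat.lt_succ_of_le hn
  have haligned : USphere.ReflectionAligned f g := fun v x y hx hy => by
    refine USphere.mul_nonneg_of_rieszForm_polarize_eq hk_mono (le_antisymm ?_ ?_) hx hy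
    · exact USphere.rieszForm_le_rieszForm_polarize hk_mono.monotoneOn v f g
    · calc USphere.rieszForm k (USphere.polarize v f) (USphere.polarize v g)
        _ ≤ _ := USphere.rieszForm_le_rieszForm_symmetrization hn hk_mono.monotoneOn _ _
        _ = USphere.rieszForm k (USphere.symmetrization hn f) (USphere.symmetrization hn g) := by
          rw [USphere.symmetrization_polarize, USphere.symmetrization_polarize]
        _ = USphere.rieszForm k f g := heq.symm
  obtain ⟨u, hu⟩ := haligned.exists_forall_isPolarized hrank hf hg
  exact ⟨u, USphere.isRadialDecreasing_of_forall_isPolarized fun v hv => (hu v hv).1,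
    USphere.isRadialDecreasing_of_forall_isPolarized fun v hv => (hu v hv).2⟩
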